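/- Let $\mathcal H$ and $\mathcal K$ be real or complex Hilbert spaces (over the same field), let $A,B:\mathcal H\to\mathcal K$ be bounded linear operators and let $\mathcal M,\mathcal N\subseteq\mathcal H$ be closed subspaces. Write $\mathcal R(\cdot)$ for the range of an operator, and call a linear operator $C:\mathcal D(C)\to\mathcal K$, with domain a linear subspace $\mathcal D(C)\subseteq\mathcal H$, closed if its graph is closed in $\mathcal H\times\mathcal K$. (1) There exists a closed operator $C$ with domain $\mathcal D(C)=\mathcal M+\mathcal N$ that coincides with $A$ on $\mathcal M$ and with $B$ on $\mathcal N$ if and only if $$\mathcal R(A^*-B^*)+\mathcal M^\perp+\mathcal N^\perp=\overline{\mathcal M^\perp+\mathcal N^\perp}.$$ (2) Suppose that $A$ and $B$ coincide on $\mathcal M\cap\mathcal N$, and let $C_{\mathcal M,\mathcal N}(A,B)$ be the (unique) operator with domain $\mathcal M+\mathcal N$ that coincides with $A$ on $\mathcal M$ and with $B$ on $\mathcal N$. Then $C_{\mathcal M,\mathcal N}(A,B)$ is closed if and only if $\mathcal R(A^*-B^*)+\mathcal M^\perp+\mathcal N^\perp=\overline{\mathcal M^\perp+\mathcal N^\perp}$,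 and also if and only if the subspace $\mathcal R(A^*-B^*)+\mathcal M^\perp+\mathcal N^\perp$ is closed. -/

import Mathlib

/-- The two restrictions `A|_M` and `B|_N` agree on the intersection of their domains as soon as
`A` and `B` coincide on `M ∩ N`. -/
theorem toPMap_agree {𝕜 H K : Type*} [RCLike 𝕜]
    [NormedAddCommGroup H] [InnerProductSpace 𝕜 H]
    [NormedAddCommGroup K] [InnerProductSpace 𝕜 K]
    (M N : Submodule 𝕜 H) (A B : H →L[𝕜] K) (hAB : ∀ x ∈ M ⊓ N, A x = B x)
    (x : ((A : H →ₗ[𝕜] K).toPMap M).domain) (y : ((B : H →ₗ[𝕜] K).toPMap N).domain)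
    (hxy : (x : H) = y) :
    (A : H →ₗ[𝕜] K).toPMap M x = (B : H →ₗ[𝕜] K).toPMap N y := by
  have hx : (x : H) ∈ M ⊓ N := ⟨x.2, hxy ▸ y.2⟩
  have h := hAB _ hx
  change A (x : H) = B (y : H)
  rw [h, hxy]

/-- The operator `C_{M,N}(A,B)` with domain `M + N` that coincides with `A` on `M` and with `B`
on `N`; it is defined when `A` and `B` coincide on `M ∩ N`. -/
noncomputable def inducedOperator {𝕜 H K : Type*} [RCLike 𝕜]
    [NormedAddCommGroup H] [InnerProductSpace 𝕜 H]
    [NormedAddCommGroup K] [InnerProductSpace 𝕜 K]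
    (M N : Submodule 𝕜 H) (A B : H →L[𝕜] K) (hAB : ∀ x ∈ M ⊓ N, A x = B x) : H →ₗ.[𝕜] K :=
  ((A : H →ₗ[𝕜] K).toPMap M).sup ((B : H →ₗ[𝕜] K).toPMap N) (toPMap_agree M N A B hAB)

/-- `IsSimultaneousExtension M N A B C`: the (not necessarily bounded) operator `C` has domain
`M + N`, coincides with `A` on `M` and coincides with `B` on `N`. -/
def IsSimultaneousExtension {𝕜 H K : Type*} [RCLike 𝕜]
    [NormedAddCommGroup H] [InnerProductSpace 𝕜 H]
    [NormedAddCommGroup K] [InnerProductSpace 𝕜 K]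
    (M N : Submodule 𝕜 H) (A B : H →L[𝕜] K) (C : H →ₗ.[𝕜] K) : Prop :=
  C.domain = M ⊔ N ∧
    (∀ x : C.domain, (x : H) ∈ M → C x = A x) ∧ (∀ x : C.domain, (x : H) ∈ N → C x = B x)

/-- `C_{M,N}(A,B)` is the one and only operator with domain `M + N` that coincides with `A` on `M`
and with `B` on `N`. -/
theorem isSimultaneousExtension_iff {𝕜 H K : Type*} [RCLike 𝕜]
    [NormedAddCommGroup H] [InnerProductSpace 𝕜 H]
    [NormedAddCommGroup K] [InnerProductSpace 𝕜 K]
    (M N : Submodule 𝕜 H) (A B : H →L[𝕜] K) (hAB : ∀ x ∈ M ⊓ N, A x = B x) (C : H →ₗ.[𝕜] K) :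
    IsSimultaneousExtension M N A B C ↔ C = inducedOperator M N A B hAB := by
  constructor
  · rintro ⟨hd, hA, hB⟩
    refine (LinearPMap.eq_of_le_of_domain_eq (LinearPMap.sup_le (toPMap_agree M N A B hAB) ?_ ?_) ?_).symm
    · refine ⟨by rw [hd]; exact le_sup_left, fun x y hxy => ?_⟩
      rw [hA y (hxy ▸ x.2), ← hxy]
      rfl
    · refine ⟨by rw [hd]; exact le_sup_right, fun x y hxy => ?_⟩
      rw [hB y (hxy ▸ x.2), ← hxy]
      rfl
    · rw [hd]
      rfl
  · rintro rfl
    refine ⟨rfl, fun x hx => ?_, fun x hx => ?_⟩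
    · exact ((LinearPMap.left_le_sup _ _ (toPMap_agree M N A B hAB)).2
        (x := ⟨(x : H), hx⟩) (y := x) rfl).symm
    · exact ((LinearPMap.right_le_sup _ _ (toPMap_agree M N A B hAB)).2
        (x := ⟨(x : H), hx⟩) (y := x) rfl).symm

/-!
The graph of `C_{M,N}(A,B)` is the sum of the graphs of `A|_M` and `B|_N`, two closed subspaces of
the Hilbert space `H ⊕ K`, and such a sum is closed if and only if the sum of the orthogonal
complements is. The complement of the graph of `A|_M` consists of the `(h, k)` with
`h + A* k ∈ Mᗮ`, so the sum of the two complements is the preimage of `R(A* - B*) + Mᗮ + Nᗮ` under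
the open surjection `(h, k) ↦ h + A* k`; hence `C_{M,N}(A,B)` is closed if and only if that
subspace is. Finally, `A` and `B` coincide on `M ∩ N` exactly when `R(A* - B*)` lies in
`(M ∩ N)ᗮ`, which is the closure of `Mᗮ + Nᗮ`.

The statement about sums of closed subspaces is the closed range theorem for the projection of `Y`
onto `Xᗮ`: its range is closed if and only if `X + Y` is closed, and its adjoint is the projection
of `Xᗮ` onto `Y`, whose range is closed if and only if `Xᗮ + Yᗮ` is closed.
-/

section Adjoint

open ContinuousLinearMap
open scoped InnerProduct

variable {𝕜 E F : Type*} [RCLike 𝕜]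
  [NormedAddCommGroup E] [InnerProductSpace 𝕜 E] [CompleteSpace E]
  [NormedAddCommGroup F] [InnerProductSpace 𝕜 F] [CompleteSpace F]

theorem exists_antilipschitzWith_adjoint_of_surjective {T : E →L[𝕜] F}
    (hT : Function.Surjective T) :
    ∃ c, AntilipschitzWith c (T†) := by
  obtain ⟨c, hc, hpre⟩ := T.exists_preimage_norm_le hT
  refine ⟨⟨c, hc.le⟩, (T†).antilipschitz_of_bound fun y => ?_⟩
  obtain ⟨x, hxy, hx⟩ := hpre y
  have hsq : ‖y‖ * ‖y‖ ≤ c * ‖(T†) y‖ * ‖y‖ := calc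
    ‖y‖ * ‖y‖ = ‖inner 𝕜 x ((T†) y)‖ := by
      rw [adjoint_inner_right, hxy, inner_self_eq_norm_sq_to_K, norm_pow, RCLike.norm_ofReal,
        abs_norm, sq]
    _ ≤ ‖x‖ * ‖(T†) y‖ := norm_inner_le_norm _ _
    _ ≤ c * ‖y‖ * ‖(T†) y‖ := by gcongr
    _ = c * ‖(T†) y‖ * ‖y‖ := by ring
  rcases (norm_nonneg y).eq_or_lt with hy | hy
  · rw [← hy]
    positivity
  · exact le_of_mul_le_mul_right hsq hy

theorem isClosed_range_adjoint {T : E →L[𝕜] F} (hT : IsClosed (T.range : Set F)) :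
    IsClosed (T†.range : Set E) := by
  have : CompleteSpace T.range := hT.completeSpace_coe
  have hfactor : T† = T.rangeRestrict† ∘L T.range.orthogonalProjectionOnto := by
    rw [← Submodule.adjoint_subtypeL, ← adjoint_comp]
    rfl
  have hrange : T†.range = T.rangeRestrict†.range := by
    rw [hfactor]
    exact LinearMap.range_comp_of_range_eq_top _ (LinearMap.range_eq_top.2 fun y =>
      ⟨y, T.range.orthogonalProjectionOnto_mem_subspace_eq_self y⟩)
  obtain ⟨c, hc⟩ := exists_antilipschitzWith_adjoint_of_surjective (T := T.rangeRestrict)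
    (LinearMap.surjective_rangeRestrict _)
  rw [hrange]
  exact hc.isClosed_range (T.rangeRestrict†).uniformContinuous

theorem isClosed_range_adjoint_iff {T : E →L[𝕜] F} :
    IsClosed (T†.range : Set E) ↔ IsClosed (T.range : Set F) :=
  ⟨fun h => adjoint_adjoint T ▸ isClosed_range_adjoint h, isClosed_range_adjoint⟩

theorem orthogonal_map_eq_comap_adjoint (T : E →L[𝕜] F) (M : Submodule 𝕜 E) :
    (M.map (T : E →ₗ[𝕜] F))ᗮ = Mᗮ.comap (T† : F →ₗ[𝕜] E) := by
  ext y
  simp only [Submodule.mem_orthogonal, Submodule.mem_map, forall_exists_index, and_imp,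
    forall_apply_eq_imp_iff₂, Submodule.mem_comap, coe_coe, adjoint_inner_right]

theorem range_adjoint_le_orthogonal_iff {T : E →L[𝕜] F} {L : Submodule 𝕜 E} :
    T†.range ≤ Lᗮ ↔ L ≤ T.ker := by
  rw [← Submodule.isOrtho_iff_le, Submodule.isOrtho_comm, Submodule.isOrtho_iff_le,
    orthogonal_range, adjoint_adjoint]

end Adjoint

section SumOfSubspaces

variable {𝕜 E : Type*} [RCLike 𝕜] [NormedAddCommGroup E] [InnerProductSpace 𝕜 E]

theorem isClosed_orthogonal_sup_iff_isClosed_range (U V : Submodule 𝕜 E)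
    [U.HasOrthogonalProjection] :
    IsClosed ((Uᗮ ⊔ V : Submodule 𝕜 E) : Set E) ↔
      IsClosed ((U.orthogonalProjectionOnto ∘L V.subtypeL).range : Set U) := by
  have hquot : Topology.IsQuotientMap U.orthogonalProjectionOnto :=
    .of_inverse U.subtypeL.continuous U.orthogonalProjectionOnto.continuous
      U.orthogonalProjectionOnto_mem_subspace_eq_self
  have hrange : (U.orthogonalProjectionOnto ∘L V.subtypeL).range =
      V.map (U.orthogonalProjectionOnto : E →ₗ[𝕜] U) := by
    rw [ContinuousLinearMap.toLinearMap_comp, LinearMap.range_comp]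
    exact congrArg _ V.range_subtype
  rw [hrange, ← hquot.isClosed_preimage, sup_comm, ← U.ker_orthogonalProjectionOnto,
    ← Submodule.comap_map_eq]
  rfl

variable [CompleteSpace E]

theorem isClosed_orthogonal_sup_orthogonal_iff {X Y : Submodule 𝕜 E}
    (hX : IsClosed (X : Set E)) (hY : IsClosed (Y : Set E)) :
    IsClosed ((Xᗮ ⊔ Yᗮ : Submodule 𝕜 E) : Set E) ↔
      IsClosed ((X ⊔ Y : Submodule 𝕜 E) : Set E) := by
  have : CompleteSpace X := hX.completeSpace_coe
  have : CompleteSpace Y := hY.completeSpace_coe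
  have hadjoint : ContinuousLinearMap.adjoint (Xᗮ.orthogonalProjectionOnto ∘L Y.subtypeL) =
      Y.orthogonalProjectionOnto ∘L Xᗮ.subtypeL := by
    rw [ContinuousLinearMap.adjoint_comp, Submodule.adjoint_subtypeL,
      Submodule.adjoint_orthogonalProjectionOnto]
  rw [sup_comm, isClosed_orthogonal_sup_iff_isClosed_range, ← hadjoint,
    isClosed_range_adjoint_iff, ← isClosed_orthogonal_sup_iff_isClosed_range,
    X.orthogonal_orthogonal]

theorem orthogonal_inf_eq_topologicalClosure_sup {X Y : Submodule 𝕜 E}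
    (hX : IsClosed (X : Set E)) (hY : IsClosed (Y : Set E)) :
    (X ⊓ Y)ᗮ = (Xᗮ ⊔ Yᗮ).topologicalClosure :=
  congrArg ClosedSubmodule.toSubmodule
    (ClosedSubmodule.sup_orthogonal (⟨X, hX⟩ : ClosedSubmodule 𝕜 E) ⟨Y, hY⟩).symm

end SumOfSubspaces

section LinearAlgebra

variable {R E F : Type*} [Ring R] [AddCommGroup E] [Module R E] [AddCommGroup F] [Module R F]

theorem comap_sup_comap_of_common_preimage {S T : E →ₗ[R] F}
    (hST : ∀ y, ∃ x, S x = y ∧ T x = y) (X Y : Submodule R F) :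
    X.comap S ⊔ Y.comap T = ((S - T).range ⊔ X ⊔ Y).comap S := by
  ext p
  simp only [Submodule.mem_comap, Submodule.mem_sup, LinearMap.mem_range, exists_exists_eq_and]
  constructor
  · rintro ⟨a, ha, b, hb, rfl⟩
    refine ⟨(S - T) b + S a, ⟨b, S a, ha, rfl⟩, T b, hb, ?_⟩
    rw [LinearMap.sub_apply, map_add]
    abel
  · rintro ⟨_, ⟨c, x, hx, rfl⟩, y, hy, hp⟩
    obtain ⟨d, hSd, hTd⟩ := hST (y - T c)
    have hT : T (c + d) = y := by rw [map_add, hTd, add_sub_cancel]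
    have hS : S (p - (c + d)) = x := by
      rw [map_sub, map_add, hSd, ← hp, LinearMap.sub_apply]
      abel
    exact ⟨p - (c + d), hS ▸ hx, c + d, hT ▸ hy, sub_add_cancel _ _⟩

theorem linearPMap_graph_toPMap (f : E →ₗ[R] F) (M : Submodule R E) :
    (f.toPMap M).graph = M.map (LinearMap.id.prod f) := by
  ext ⟨x, y⟩
  simp [LinearPMap.mem_graph_iff]

theorem linearPMap_graph_sup (f g : E →ₗ.[R] F)
    (h : ∀ (x : f.domain) (y : g.domain), (x : E) = y → f x = g y) :
    (f.sup g h).graph = f.graph ⊔ g.graph := by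
  refine le_antisymm (fun p hp => ?_) (sup_le (LinearPMap.le_graph_of_le (f.left_le_sup g h))
    (LinearPMap.le_graph_of_le (f.right_le_sup g h)))
  obtain ⟨⟨z, hz⟩, rfl⟩ := (LinearPMap.mem_graph_iff' _).1 hp
  obtain ⟨x, hx, y, hy, rfl⟩ := Submodule.mem_sup.1 hz
  have hval : f.sup g h ⟨x + y, hz⟩ = f ⟨x, hx⟩ + g ⟨y, hy⟩ :=
    LinearPMap.sup_apply h ⟨x, hx⟩ ⟨y, hy⟩ ⟨x + y, hz⟩ rfl
  rw [hval]
  exact Submodule.add_mem_sup (f.mem_graph ⟨x, hx⟩) (g.mem_graph ⟨y, hy⟩)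

end LinearAlgebra

theorem sup_eq_topologicalClosure_iff {R E : Type*} [Semiring R] [AddCommMonoid E] [Module R E]
    [TopologicalSpace E] [ContinuousAdd E] [ContinuousConstSMul R E] {X Y : Submodule R E} :
    X ⊔ Y = Y.topologicalClosure ↔
      X ≤ Y.topologicalClosure ∧ IsClosed ((X ⊔ Y : Submodule R E) : Set E) := by
  refine ⟨fun h => ⟨h ▸ le_sup_left, h ▸ Y.isClosed_topologicalClosure⟩, fun ⟨hX, hXY⟩ => ?_⟩
  exact le_antisymm (sup_le hX Y.le_topologicalClosure)
    (Y.topologicalClosure_minimal le_sup_right hXY)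

section InducedOperator

open ContinuousLinearMap
open scoped InnerProduct

variable {𝕜 H K : Type*} [RCLike 𝕜] [NormedAddCommGroup H] [InnerProductSpace 𝕜 H]
  [NormedAddCommGroup K] [InnerProductSpace 𝕜 K]

/-- The graph embedding `x ↦ (x, A x)`. It takes values in the Hilbert space sum of `H` and `K`,
because the product `H × K` carries the sup norm. -/
noncomputable def graphMap (A : H →L[𝕜] K) : H →L[𝕜] WithLp 2 (H × K) :=
  (WithLp.prodContinuousLinearEquiv 2 𝕜 H K).symm ∘L (ContinuousLinearMap.id 𝕜 H).prod A

theorem isClosed_map_graphMap (A : H →L[𝕜] K) {M : Submodule 𝕜 H} (hM : IsClosed (M : Set H)) :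
    IsClosed (M.map (graphMap A : H →ₗ[𝕜] WithLp 2 (H × K)) : Set (WithLp 2 (H × K))) := by
  have hfst : Function.LeftInverse (WithLp.fstL 2 𝕜 H K) (graphMap A) := fun _ => rfl
  exact (hfst.isClosedEmbedding (WithLp.fstL 2 𝕜 H K).continuous
    (graphMap A).continuous).isClosedMap _ hM

theorem isClosed_inducedOperator_iff_isClosed_sup {A B : H →L[𝕜] K} {M N : Submodule 𝕜 H}
    (hAB : ∀ x ∈ M ⊓ N, A x = B x) :
    (inducedOperator M N A B hAB).IsClosed ↔
      IsClosed ((M.map (graphMap A : H →ₗ[𝕜] WithLp 2 (H × K)) ⊔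
        N.map (graphMap B : H →ₗ[𝕜] WithLp 2 (H × K)) : Submodule 𝕜 (WithLp 2 (H × K))) :
          Set (WithLp 2 (H × K))) := by
  let e := (WithLp.prodContinuousLinearEquiv 2 𝕜 H K).symm
  have hgraph : (inducedOperator M N A B hAB).graph.map (e : H × K →ₗ[𝕜] WithLp 2 (H × K)) =
      M.map (graphMap A : H →ₗ[𝕜] WithLp 2 (H × K)) ⊔
        N.map (graphMap B : H →ₗ[𝕜] WithLp 2 (H × K)) := by
    rw [inducedOperator, linearPMap_graph_sup, linearPMap_graph_toPMap, linearPMap_graph_toPMap,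
      Submodule.map_sup, ← Submodule.map_comp, ← Submodule.map_comp]
    rfl
  rw [← hgraph, LinearPMap.IsClosed, ← e.toHomeomorph.isClosed_image]
  rfl

variable [CompleteSpace H] [CompleteSpace K]

theorem adjoint_graphMap_apply (A : H →L[𝕜] K) (p : WithLp 2 (H × K)) :
    ((graphMap A)†) p = p.fst + (A†) p.snd := by
  refine ext_inner_left 𝕜 fun x => ?_
  rw [adjoint_inner_right, inner_add_right, adjoint_inner_right, WithLp.prod_inner_apply]
  rfl

theorem range_adjoint_graphMap_sub (A B : H →L[𝕜] K) :
    ((graphMap A)† - (graphMap B)†).range = (A† - B†).range := by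
  have hfactor : (graphMap A)† - (graphMap B)† = (A† - B†) ∘L WithLp.sndL 2 𝕜 H K := by
    ext p
    simp only [sub_apply, comp_apply, adjoint_graphMap_apply, add_sub_add_left_eq_sub]
    rfl
  rw [hfactor]
  exact LinearMap.range_comp_of_range_eq_top _
    (LinearMap.range_eq_top.2 fun y => ⟨WithLp.toLp 2 (0, y), rfl⟩)

theorem isClosed_inducedOperator_iff {A B : H →L[𝕜] K} {M N : Submodule 𝕜 H}
    (hM : IsClosed (M : Set H)) (hN : IsClosed (N : Set H)) (hAB : ∀ x ∈ M ⊓ N, A x = B x) :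
    (inducedOperator M N A B hAB).IsClosed ↔
      IsClosed (((A† - B†).range ⊔ Mᗮ ⊔ Nᗮ : Submodule 𝕜 H) : Set H) := by
  have hpre : ∀ y, ∃ p, ((graphMap A)†) p = y ∧ ((graphMap B)†) p = y := fun y =>
    ⟨WithLp.toLp 2 (y, 0), by simp [adjoint_graphMap_apply], by simp [adjoint_graphMap_apply]⟩
  have hquot : Topology.IsQuotientMap ((graphMap A)†) :=
    ((graphMap A)†).isQuotientMap fun y => (hpre y).imp fun _ => And.left
  have hsup : Mᗮ.comap ((graphMap A)† : WithLp 2 (H × K) →ₗ[𝕜] H) ⊔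
        Nᗮ.comap ((graphMap B)† : WithLp 2 (H × K) →ₗ[𝕜] H) =
      ((A† - B†).range ⊔ Mᗮ ⊔ Nᗮ).comap ((graphMap A)† : WithLp 2 (H × K) →ₗ[𝕜] H) := by
    rw [comap_sup_comap_of_common_preimage hpre, ← range_adjoint_graphMap_sub]
    rfl
  rw [isClosed_inducedOperator_iff_isClosed_sup,
    ← isClosed_orthogonal_sup_orthogonal_iff (isClosed_map_graphMap A hM)
      (isClosed_map_graphMap B hN),
    orthogonal_map_eq_comap_adjoint, orthogonal_map_eq_comap_adjoint, hsup,
    ← hquot.isClosed_preimage]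
  rfl

theorem range_adjoint_sub_le_topologicalClosure_iff {A B : H →L[𝕜] K} {M N : Submodule 𝕜 H}
    (hM : IsClosed (M : Set H)) (hN : IsClosed (N : Set H)) :
    (A† - B†).range ≤ (Mᗮ ⊔ Nᗮ).topologicalClosure ↔ ∀ x ∈ M ⊓ N, A x = B x := by
  rw [← orthogonal_inf_eq_topologicalClosure_sup hM hN, ← map_sub,
    range_adjoint_le_orthogonal_iff]
  exact forall₂_congr fun _ _ => sub_eq_zero

theorem range_sup_eq_topologicalClosure_iff {A B : H →L[𝕜] K} {M N : Submodule 𝕜 H}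
    (hM : IsClosed (M : Set H)) (hN : IsClosed (N : Set H)) :
    (A† - B†).range ⊔ Mᗮ ⊔ Nᗮ = (Mᗮ ⊔ Nᗮ).topologicalClosure ↔
      ∃ hAB : ∀ x ∈ M ⊓ N, A x = B x, (inducedOperator M N A B hAB).IsClosed := by
  simp only [isClosed_inducedOperator_iff hM hN, exists_prop]
  rw [sup_assoc, sup_eq_topologicalClosure_iff,
    range_adjoint_sub_le_topologicalClosure_iff hM hN]

end InducedOperator

section SimultaneousExtension

variable {𝕜 H K : Type*} [RCLike 𝕜] [NormedAddCommGroup H] [InnerProductSpace 𝕜 H]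
  [NormedAddCommGroup K] [InnerProductSpace 𝕜 K]

theorem IsSimultaneousExtension.eq_on_inf {A B : H →L[𝕜] K} {M N : Submodule 𝕜 H}
    {C : H →ₗ.[𝕜] K} (hC : IsSimultaneousExtension M N A B C) : ∀ x ∈ M ⊓ N, A x = B x := by
  obtain ⟨hdom, hA, hB⟩ := hC
  intro x hx
  have hxC : x ∈ C.domain := hdom ▸ Submodule.mem_sup_left hx.1
  exact (hA ⟨x, hxC⟩ hx.1).symm.trans (hB ⟨x, hxC⟩ hx.2)

theorem exists_isClosed_isSimultaneousExtension_iff {A B : H →L[𝕜] K} {M N : Submodule 𝕜 H} :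
    (∃ C : H →ₗ.[𝕜] K, C.IsClosed ∧ IsSimultaneousExtension M N A B C) ↔
      ∃ hAB : ∀ x ∈ M ⊓ N, A x = B x, (inducedOperator M N A B hAB).IsClosed := by
  constructor
  · rintro ⟨C, hclosed, hC⟩
    have hAB := hC.eq_on_inf
    exact ⟨hAB, (isSimultaneousExtension_iff M N A B hAB C).1 hC ▸ hclosed⟩
  · rintro ⟨hAB, hclosed⟩
    exact ⟨_, hclosed, (isSimultaneousExtension_iff M N A B hAB _).2 rfl⟩

end SimultaneousExtension

theorem theorem4p6 {𝕜 H K : Type*} [RCLike 𝕜]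
    [NormedAddCommGroup H] [InnerProductSpace 𝕜 H] [CompleteSpace H]
    [NormedAddCommGroup K] [InnerProductSpace 𝕜 K] [CompleteSpace K]
    (A B : H →L[𝕜] K) (M N : Submodule 𝕜 H)
    (hM : IsClosed (M : Set H)) (hN : IsClosed (N : Set H)) :
    ((∃ C : H →ₗ.[𝕜] K, C.IsClosed ∧ IsSimultaneousExtension M N A B C) ↔
      (ContinuousLinearMap.adjoint A - ContinuousLinearMap.adjoint B).range ⊔ Mᗮ ⊔ Nᗮ
        = (Mᗮ ⊔ Nᗮ).topologicalClosure) ∧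
    (∀ hAB : ∀ x ∈ M ⊓ N, A x = B x,
      ((inducedOperator M N A B hAB).IsClosed ↔
        (ContinuousLinearMap.adjoint A - ContinuousLinearMap.adjoint B).range ⊔ Mᗮ ⊔ Nᗮ
          = (Mᗮ ⊔ Nᗮ).topologicalClosure) ∧
      ((inducedOperator M N A B hAB).IsClosed ↔
        IsClosed (((ContinuousLinearMap.adjoint A - ContinuousLinearMap.adjoint B).range
          ⊔ Mᗮ ⊔ Nᗮ : Submodule 𝕜 H) : Set H))) := by
  have hrange := range_sup_eq_topologicalClosure_iff (A := A) (B := B) hM hN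
  refine ⟨exists_isClosed_isSimultaneousExtension_iff.trans hrange.symm, fun hAB => ⟨?_, ?_⟩⟩
  · rw [hrange, exists_prop_of_true hAB]
  · exact isClosed_inducedOperator_iff hM hN hAB
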